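/- Let $d\ge 2$ be an integer, let $\gamma>0$ and $s$ be real numbers, and for a tempered distribution $f\in H^s(\mathbb R^d)$ write $\hat f(\xi)=\int_{\mathbb R^d}e^{-ix\cdot\xi}f(x)\,dx$ for its Fourier transform (which is a locally integrable function) and $\|f\|_{H^s(\mathbb R^d)}=\big\|(1+|\xi|^2)^{s/2}\hat f(\xi)\big\|_{L^2(d\xi)}$. For $x\in\mathbb R^d$ and $t>0$ put \[ P_\gamma f(x,t)=\frac1{(2\pi)^d}\int_{\mathbb R^d}e^{i(x\cdot\xi+t|\xi|^2)}\,e^{-t^\gamma|\xi|^2}\,\hat f(\xi)\,d\xi . \] Suppose that the maximal estimate \[ \Big\|\sup_{0<t<1}|P_\gamma f(\cdot,t)|\Big\|_{L^2(B(0,1))}\le C\,\|f\|_{H^s(\mathbb R^d)} \] holds for all $f\in H^s(\mathbb R^d)$ with a finite constant $C$ that does not depend on $f$. Then \[ s\ \ge\ \min\Big\{\frac d{d+1}\Big(1-\frac1\gamma\Big)^+,\ \frac d{2(d+1)}\Big\},\qquad\text{where } b^+=\max(b,0). \] -/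

import Mathlib

noncomputable section

namespace ComplexTimeSchrodinger

open MeasureTheory FourierTransform TemperedDistribution
open scoped ENNReal NNReal SchwartzMap

/-- The Euclidean space `ℝ^d`. -/
abbrev Space (d : ℕ) : Type := EuclideanSpace ℝ (Fin d)

/-- The Fourier transform of the tempered distribution `f`, in Mathlib's normalization
`𝓕 φ (η) = ∫ exp(-2πi x·η) φ(x) dx`, is given by the locally integrable function `g`. -/
def IsFourierDensity {d : ℕ} (f : 𝓢'(Space d, ℂ)) (g : Space d → ℂ) : Prop :=
  LocallyIntegrable g ∧
    ∀ φ : 𝓢(Space d, ℂ), Integrable (fun η ↦ φ η • g η) ∧ (𝓕 f) φ = ∫ η, φ η • g η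

/-- The function representing a Fourier transform is unique up to null sets. -/
theorem IsFourierDensity.ae_eq {d : ℕ} {f : 𝓢'(Space d, ℂ)} {g g' : Space d → ℂ}
    (hg : IsFourierDensity f g) (hg' : IsFourierDensity f g') : g =ᵐ[volume] g' := by
  refine ae_eq_of_integral_contDiff_smul_eq hg.1 hg'.1 fun h h_diff h_supp ↦ ?_
  have h1 : HasCompactSupport (fun x ↦ (h x : ℂ)) :=
    h_supp.comp_left (g := fun r : ℝ ↦ (r : ℂ)) (by simp)
  have h2 : ContDiff ℝ ((⊤ : ℕ∞) : WithTop ℕ∞) (fun x ↦ (h x : ℂ)) :=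
    Complex.ofRealCLM.contDiff.comp h_diff
  have key := (hg.2 (h1.toSchwartzMap h2)).2.symm.trans (hg'.2 (h1.toSchwartzMap h2)).2
  simpa using key

/-- The Fourier transform of an element of `H^s`, for any real `s`, is a function. -/
theorem exists_isFourierDensity {d : ℕ} {s : ℝ} {f : 𝓢'(Space d, ℂ)}
    (hf : MemSobolev s 2 f) : ∃ g, IsFourierDensity f g := by
  obtain ⟨u, hu⟩ := memSobolev_iff_exists_smulLeftCLM_fourier.mp hf
  have hw : (fun x : Space d ↦ (((1 + ‖x‖ ^ 2) ^ (-s / 2) : ℝ) : ℂ)).HasTemperateGrowth := by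
    fun_prop
  have hF : 𝓕 f = smulLeftCLM ℂ (fun x : Space d ↦ (((1 + ‖x‖ ^ 2) ^ (-s / 2) : ℝ) : ℂ))
      (u : 𝓢'(Space d, ℂ)) := by
    rw [← hu, smulLeftCLM_smulLeftCLM_apply (by fun_prop) hw]
    have h1 : ((fun x : Space d ↦ (((1 + ‖x‖ ^ 2) ^ (s / 2) : ℝ) : ℂ)) *
        fun x : Space d ↦ (((1 + ‖x‖ ^ 2) ^ (-s / 2) : ℝ) : ℂ)) = fun _ ↦ 1 := by
      ext x
      rw [Pi.mul_apply]
      norm_cast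
      rw [← Real.rpow_add (by positivity)]
      ring_nf
      simp
    rw [h1]
    simp
  refine ⟨fun x ↦ (((1 + ‖x‖ ^ 2) ^ (-s / 2) : ℝ) : ℂ) * u x, ?_, fun φ ↦ ?_⟩
  · have hu' : LocallyIntegrable u := (Lp.memLp u).locallyIntegrable (by norm_num)
    have := (locallyIntegrableOn_univ.mpr hu').continuousOn_mul hw.1.continuous.continuousOn
      isOpen_univ.isLocallyClosed
    exact locallyIntegrableOn_univ.mp this
  · have hφ : ∀ x, SchwartzMap.smulLeftCLM ℂ
        (fun x : Space d ↦ (((1 + ‖x‖ ^ 2) ^ (-s / 2) : ℝ) : ℂ)) φ x • u x =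
        φ x • ((((1 + ‖x‖ ^ 2) ^ (-s / 2) : ℝ) : ℂ) * u x) := by
      intro x
      rw [SchwartzMap.smulLeftCLM_apply_apply hw]
      simp only [smul_eq_mul]
      ring
    constructor
    · simp_rw [← hφ]
      exact ((SchwartzMap.smulLeftCLM ℂ
        (fun x : Space d ↦ (((1 + ‖x‖ ^ 2) ^ (-s / 2) : ℝ) : ℂ)) φ).memLp 2).integrable_mul
        (Lp.memLp u)
    · rw [hF, smulLeftCLM_apply_apply, Lp.toTemperedDistribution_apply]
      simp_rw [hφ]

open Classical in
/-- The Fourier transform `f̂(ξ) = ∫ exp(-i x·ξ) f(x) dx`, as a function, of a tempered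
distribution `f` (determined almost everywhere; `0` if the Fourier transform is not a locally
integrable function, which does not happen on any Sobolev space `H^s`). -/
def fhat {d : ℕ} (f : 𝓢'(Space d, ℂ)) (ξ : Space d) : ℂ :=
  if h : ∃ g, IsFourierDensity f g then h.choose ((2 * Real.pi)⁻¹ • ξ) else 0

/-- The `H^s` norm `‖(1 + |ξ|²)^{s/2} f̂(ξ)‖_{L²(dξ)}`. -/
def sobolevNorm {d : ℕ} (s : ℝ) (f : 𝓢'(Space d, ℂ)) : ℝ≥0∞ :=
  eLpNorm (fun ξ : Space d ↦ (((1 + ‖ξ‖ ^ 2) ^ (s / 2) : ℝ) : ℂ) * fhat f ξ) 2 volume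

/-- The Schrödinger operator with complex time
`P_γ f(x,t) = (2π)^{-d} ∫ exp(i (x·ξ + t|ξ|²)) exp(-t^γ |ξ|²) f̂(ξ) dξ`. -/
def P {d : ℕ} (γ : ℝ) (f : 𝓢'(Space d, ℂ)) (x : Space d) (t : ℝ) : ℂ :=
  (((2 * Real.pi) ^ d : ℝ) : ℂ)⁻¹ *
    ∫ ξ : Space d, Complex.exp (Complex.I * ((inner ℝ x ξ + t * ‖ξ‖ ^ 2 : ℝ) : ℂ)) *
      Complex.exp ((-(t ^ γ * ‖ξ‖ ^ 2) : ℝ) : ℂ) * fhat f ξ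

/-- The maximal function `sup_{0 < t < 1} |P_γ f(x,t)|`, with values in `[0, ∞]`. -/
def maximalFunction {d : ℕ} (γ : ℝ) (f : 𝓢'(Space d, ℂ)) (x : Space d) : ℝ≥0∞ :=
  ⨆ t ∈ Set.Ioo (0 : ℝ) 1, ‖P γ f x t‖ₑ

/-- The maximal estimate `‖sup_{0<t<1} |P_γ f(·,t)|‖_{L²(B(0,1))} ≤ C ‖f‖_{H^s}`, with a finite
constant `C` uniform over all `f ∈ H^s(ℝ^d)`. -/
def MaximalEstimate (d : ℕ) (γ s : ℝ) : Prop :=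
  ∃ C : ℝ≥0, ∀ f : 𝓢'(Space d, ℂ), MemSobolev s 2 f →
    eLpNorm (maximalFunction γ f) 2 (volume.restrict (Metric.ball (0 : Space d) 1)) ≤
      C * sobolevNorm s f

end ComplexTimeSchrodinger

end

/-!
The maximal estimate is tested on functions whose Fourier transform is the indicator function of a
bounded set `A` of frequencies of size about `R`. If every point `x` of a set `E ⊆ B(0,1)` admits a
time `t` at which the phases `x·ξ + t|ξ|²`, `ξ ∈ A`, agree modulo `2π` up to an error of `1`, and at
which `t^γ|ξ|²` is bounded on `A`, then the maximal function is `≳ |A|` on `E`, and the estimate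
forces `|A| |E| ≲ R^{2s}` (`MaximalEstimate.exists_volume_mul_volume_le`).

A cube of side `1` gives `0 ≤ s` on letting `t → 0` (`MaximalEstimate.nonneg`). This is the whole
claim for `γ ≤ 1`.

For `γ > 1` write `h²` for the time scale. In the first coordinate `A` is an interval of length
about `1/h` at `R`; a wave packet with these frequencies stays coherent up to time `h²` and moves
with velocity `-2R`, so that the first coordinate of `x` only confines `t` to a window of length
about `h/R`. In each of the other coordinates `A` is a union of `n` short intervals with spacing
`Λ = R/n`, placed at `Λ(l + α/2)`. At the times `t = 2πk/Λ²` the quadratic term `tΛ²l²` drops out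
modulo `2π`, and the remaining phase `l(xΛ + 2πkα)` is harmless as soon as `xΛ/(2π) + kα` is within
about `1/n` of an integer. With the shifts `α = p⁻¹, p⁻², …` for different coordinates, where `p` is
a large multiple of `n`, a suitable `k` exists among any `p^{d-1}` consecutive integers: its digits
in base `p` can be chosen one after the other (`exists_int_window_near_int`). The window for `t`
contains that many admissible times if `Rh` is about `n^{d+1}`. Thus a full box `E` of side about
`Rh²` is covered (`exists_coherent_time`), and `|A| |E|` is about `Rh n^{d-1}`, that is, `n^{2d}`.

The dissipation is harmless if `h² ≤ R^{-2/γ}`, and `E` fits into the unit ball if `h² ≤ R^{-1}`.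
With `h² = R^{-β}` and `β = max(2/γ, 1)`, letting `n → ∞` gives
`s ≥ d/(d+1) · (1 - β/2)` (`MaximalEstimate.le_of_timescale`), which is the claim.
-/

noncomputable section

namespace ComplexTimeSchrodinger

open MeasureTheory FourierTransform TemperedDistribution
open scoped ENNReal NNReal SchwartzMap

/-! ### Band-limited data -/

/-- Every `L²` function `u` is `(1 + |η|²)^{s/2}` times the Fourier transform of an element of
`H^s`. -/
theorem exists_memSobolev_isFourierDensity {d : ℕ} (s : ℝ)
    (u : Lp ℂ 2 (volume : Measure (Space d))) :
    ∃ f : 𝓢'(Space d, ℂ), MemSobolev s 2 f ∧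
      IsFourierDensity f fun x ↦ (((1 + ‖x‖ ^ 2) ^ (-s / 2) : ℝ) : ℂ) * u x := by
  have hw : (fun x : Space d ↦ (((1 + ‖x‖ ^ 2) ^ (-s / 2) : ℝ) : ℂ)).HasTemperateGrowth := by
    fun_prop
  set F : 𝓢'(Space d, ℂ) :=
    smulLeftCLM ℂ (fun x : Space d ↦ (((1 + ‖x‖ ^ 2) ^ (-s / 2) : ℝ) : ℂ))
      (u : 𝓢'(Space d, ℂ)) with hFdef
  have hF : 𝓕 (𝓕⁻ F) = F := fourier_fourierInv_eq F
  refine ⟨𝓕⁻ F, ?_, ?_, fun φ ↦ ?_⟩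
  · refine memSobolev_iff_exists_smulLeftCLM_fourier.mpr ⟨u, ?_⟩
    rw [hF, hFdef, smulLeftCLM_smulLeftCLM_apply hw (by fun_prop)]
    have h1 : ((fun x : Space d ↦ (((1 + ‖x‖ ^ 2) ^ (-s / 2) : ℝ) : ℂ)) *
        fun x : Space d ↦ (((1 + ‖x‖ ^ 2) ^ (s / 2) : ℝ) : ℂ)) = fun _ ↦ 1 := by
      ext x
      rw [Pi.mul_apply]
      norm_cast
      rw [← Real.rpow_add (by positivity)]
      ring_nf
      simp
    rw [h1]
    simp
  · have hu' : LocallyIntegrable u := (Lp.memLp u).locallyIntegrable (by norm_num)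
    have := (locallyIntegrableOn_univ.mpr hu').continuousOn_mul hw.1.continuous.continuousOn
      isOpen_univ.isLocallyClosed
    exact locallyIntegrableOn_univ.mp this
  · have hφ : ∀ x, SchwartzMap.smulLeftCLM ℂ
        (fun x : Space d ↦ (((1 + ‖x‖ ^ 2) ^ (-s / 2) : ℝ) : ℂ)) φ x • u x =
        φ x • ((((1 + ‖x‖ ^ 2) ^ (-s / 2) : ℝ) : ℂ) * u x) := by
      intro x
      rw [SchwartzMap.smulLeftCLM_apply_apply hw]
      simp only [smul_eq_mul]
      ring
    constructor
    · simp_rw [← hφ]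
      exact ((SchwartzMap.smulLeftCLM ℂ
        (fun x : Space d ↦ (((1 + ‖x‖ ^ 2) ^ (-s / 2) : ℝ) : ℂ)) φ).memLp 2).integrable_mul
        (Lp.memLp u)
    · rw [hF, smulLeftCLM_apply_apply, Lp.toTemperedDistribution_apply]
      simp_rw [hφ]

/-- The indicator function of a bounded measurable set is `f̂` for some `f ∈ H^s`. -/
theorem exists_memSobolev_fhat_ae_eq_indicator {d : ℕ} (s : ℝ) {A : Set (Space d)}
    (hA : MeasurableSet A) (hb : Bornology.IsBounded A) :
    ∃ f : 𝓢'(Space d, ℂ), MemSobolev s 2 f ∧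
      fhat f =ᵐ[volume] A.indicator fun _ ↦ (1 : ℂ) := by
  have hpi : (2 * Real.pi) ≠ 0 := by positivity
  -- `fhat` rescales the density by `2π`, so the density is the indicator of `A / (2π)`.
  set A' : Set (Space d) := (fun η ↦ (2 * Real.pi) • η) ⁻¹' A with hA'
  have hA'm : MeasurableSet A' := (measurable_const_smul _) hA
  have hA'b : Bornology.IsBounded A' := by
    obtain ⟨M, hM⟩ := hb.exists_norm_le
    refine (Metric.isBounded_iff_subset_closedBall 0).mpr ⟨M / (2 * Real.pi), fun η hη ↦ ?_⟩
    have h1 := hM _ hη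
    rw [norm_smul, Real.norm_of_nonneg (by positivity)] at h1
    rw [mem_closedBall_zero_iff, le_div_iff₀ (by positivity)]
    linarith
  set W : Space d → ℂ := fun x ↦ (((1 + ‖x‖ ^ 2) ^ (s / 2) : ℝ) : ℂ) with hW
  have hWc : Continuous W := by
    refine Complex.continuous_ofReal.comp (Continuous.rpow_const (by fun_prop) fun x ↦ Or.inl ?_)
    positivity
  have hmem : MemLp (A'.indicator W) 2 volume := by
    rw [memLp_indicator_iff_restrict hA'm]
    obtain ⟨M, hM⟩ := (hA'b.isCompact_closure.image hWc).isBounded.exists_norm_le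
    have : IsFiniteMeasure (volume.restrict A') := ⟨by
      simpa using hA'b.measure_lt_top⟩
    refine MemLp.of_bound hWc.aestronglyMeasurable M ?_
    filter_upwards [ae_restrict_mem hA'm] with x hx
    exact hM _ ⟨x, subset_closure hx, rfl⟩
  obtain ⟨f, hf, hd⟩ := exists_memSobolev_isFourierDensity s hmem.toLp
  refine ⟨f, hf, ?_⟩
  have hex : ∃ g, IsFourierDensity f g := ⟨_, hd⟩
  have h2 : hex.choose =ᵐ[volume] A'.indicator fun _ ↦ (1 : ℂ) := by
    filter_upwards [hex.choose_spec.ae_eq hd, hmem.coeFn_toLp] with x hx hx'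
    rw [hx, hx']
    by_cases hxA : x ∈ A'
    · rw [Set.indicator_of_mem hxA, Set.indicator_of_mem hxA]
      simp only [hW]
      norm_cast
      rw [← Real.rpow_add (by positivity)]
      ring_nf
      simp
    · simp [Set.indicator_of_notMem hxA]
  have h3 := (Measure.quasiMeasurePreserving_smul (volume : Measure (Space d))
    (inv_ne_zero hpi)).ae_eq_comp h2
  filter_upwards [h3] with ξ hξ
  rw [fhat, dif_pos hex]
  refine hξ.trans ?_
  rw [Function.comp_apply]
  have : (2 * Real.pi)⁻¹ • ξ ∈ A' ↔ ξ ∈ A := by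
    rw [hA', Set.mem_preimage, smul_inv_smul₀ hpi]
  by_cases hxA : ξ ∈ A
  · rw [Set.indicator_of_mem (this.mpr hxA), Set.indicator_of_mem hxA]
  · rw [Set.indicator_of_notMem (mt this.mp hxA), Set.indicator_of_notMem hxA]

/-! ### Coherent frequency sets -/

/-- If the phase stays within `1` of a constant modulo `2π` on the frequency set `A`, there is no
cancellation in the integral of the wave over `A`. -/
theorem le_norm_P {d : ℕ} {γ b : ℝ} {f : 𝓢'(Space d, ℂ)} {A : Set (Space d)}
    (hA : MeasurableSet A) (hb : Bornology.IsBounded A)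
    (hf : fhat f =ᵐ[volume] A.indicator fun _ ↦ (1 : ℂ)) {x : Space d} {t θ : ℝ}
    (h : ∀ ξ ∈ A, t ^ γ * ‖ξ‖ ^ 2 ≤ b ∧
      ∃ m : ℤ, |inner ℝ x ξ + t * ‖ξ‖ ^ 2 - θ - 2 * Real.pi * m| ≤ 1) :
    ((2 * Real.pi) ^ d)⁻¹ * (Real.exp (-b) * Real.cos 1) * volume.real A ≤ ‖P γ f x t‖ := by
  set G : Space d → ℂ := fun ξ ↦
    Complex.exp (Complex.I * ((inner ℝ x ξ + t * ‖ξ‖ ^ 2 : ℝ) : ℂ)) *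
      Complex.exp ((-(t ^ γ * ‖ξ‖ ^ 2) : ℝ) : ℂ) with hG
  have hGc : Continuous G := by fun_prop
  have hPe : P γ f x t = (((2 * Real.pi) ^ d : ℝ) : ℂ)⁻¹ * ∫ ξ in A, G ξ := by
    rw [P, ← integral_indicator hA]
    congr 1
    refine integral_congr_ae ?_
    filter_upwards [hf] with ξ hξ
    rw [hξ]
    by_cases hxA : ξ ∈ A <;> simp [hxA, hG]
  set H : Space d → ℂ := fun ξ ↦ Complex.exp (-(θ : ℂ) * Complex.I) * G ξ with hH
  have hHc : Continuous H := by fun_prop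
  have hHi : IntegrableOn H A :=
    (hHc.continuousOn.integrableOn_compact hb.isCompact_closure).mono_set subset_closure
  have hre : ∀ ξ ∈ A, Real.exp (-b) * Real.cos 1 ≤ (H ξ).re := by
    intro ξ hξ
    obtain ⟨h1, m, h2⟩ := h ξ hξ
    set ψ := inner ℝ x ξ + t * ‖ξ‖ ^ 2 - θ - 2 * Real.pi * m with hψ
    have e1 : H ξ = ((Real.exp (-(t ^ γ * ‖ξ‖ ^ 2)) : ℝ) : ℂ) * Complex.exp (ψ * Complex.I) := by
      have e2 : Complex.exp (ψ * Complex.I) =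
          Complex.exp (ψ * Complex.I) * Complex.exp (m * (2 * Real.pi * Complex.I)) := by
        rw [Complex.exp_int_mul_two_pi_mul_I, mul_one]
      rw [e2, Complex.ofReal_exp, ← Complex.exp_add, ← Complex.exp_add, hH, hG]
      simp only
      rw [← Complex.exp_add, ← Complex.exp_add, hψ]
      congr 1
      push_cast
      ring
    rw [e1, Complex.re_ofReal_mul, Complex.exp_ofReal_mul_I_re]
    have h3 : Real.cos 1 ≤ Real.cos ψ := by
      rw [← Real.cos_abs ψ]
      exact Real.cos_le_cos_of_nonneg_of_le_pi (abs_nonneg _)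
        (by linarith [Real.pi_gt_three]) h2
    exact mul_le_mul (Real.exp_le_exp.mpr (by linarith)) h3 Real.cos_one_pos.le
      (Real.exp_pos _).le
  have h4 : Real.exp (-b) * Real.cos 1 * volume.real A ≤ ‖∫ ξ in A, G ξ‖ := by
    calc Real.exp (-b) * Real.cos 1 * volume.real A
        = ∫ _ in A, Real.exp (-b) * Real.cos 1 := by
          rw [setIntegral_const, smul_eq_mul, mul_comm]
      _ ≤ ∫ ξ in A, (H ξ).re :=
          setIntegral_mono_on (integrableOn_const hb.measure_lt_top.ne) hHi.re hA hre
      _ = (∫ ξ in A, H ξ).re := integral_re hHi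
      _ ≤ ‖∫ ξ in A, H ξ‖ := Complex.re_le_norm _
      _ = ‖∫ ξ in A, G ξ‖ := by
          rw [hH, integral_const_mul, norm_mul]
          have : ‖Complex.exp (-(θ : ℂ) * Complex.I)‖ = 1 := by
            have := Complex.norm_exp_ofReal_mul_I (-θ)
            simpa using this
          rw [this, one_mul]
  rw [hPe, norm_mul, norm_inv, Complex.norm_real, Real.norm_of_nonneg (by positivity), mul_assoc]
  exact mul_le_mul_of_nonneg_left h4 (by positivity)

/-- The maximal estimate, tested on `f̂ = 1_A`. The set `E` consists of points that admit a time
at which the frequencies in `A` are coherent: there the maximal function is `≳ |A|`, whereas the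
Sobolev norm is `≤ B |A|^{1/2}`. -/
theorem MaximalEstimate.exists_volume_mul_volume_le {d : ℕ} {γ s : ℝ}
    (hmax : MaximalEstimate d γ s) (b : ℝ) :
    ∃ C : ℝ, 0 < C ∧ ∀ (A E : Set (Space d)) (B : ℝ), MeasurableSet A → Bornology.IsBounded A →
      MeasurableSet E → E ⊆ Metric.ball 0 1 → 0 ≤ B →
      (∀ ξ ∈ A, (1 + ‖ξ‖ ^ 2) ^ (s / 2) ≤ B) →
      (∀ x ∈ E, ∃ t ∈ Set.Ioo (0 : ℝ) 1, ∃ θ : ℝ, ∀ ξ ∈ A, t ^ γ * ‖ξ‖ ^ 2 ≤ b ∧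
        ∃ m : ℤ, |inner ℝ x ξ + t * ‖ξ‖ ^ 2 - θ - 2 * Real.pi * m| ≤ 1) →
      volume.real A * volume.real E ≤ C * B ^ 2 := by
  obtain ⟨C, hC⟩ := hmax
  set c : ℝ := ((2 * Real.pi) ^ d)⁻¹ * (Real.exp (-b) * Real.cos 1) with hc
  have hc0 : 0 < c := by have := Real.cos_one_pos; positivity
  refine ⟨((C + 1) / c) ^ 2, by positivity, fun A E B hA hAb hE hE1 hB hAB hEt ↦ ?_⟩
  obtain ⟨f, hf, hfA⟩ := exists_memSobolev_fhat_ae_eq_indicator s hA hAb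
  have hAfin : volume A ≠ ∞ := hAb.measure_lt_top.ne
  have hEfin : volume E ≠ ∞ := (Metric.isBounded_ball.subset hE1).measure_lt_top.ne
  have hup : sobolevNorm s f ≤ ENNReal.ofReal B * volume A ^ (1 / 2 : ℝ) := by
    calc sobolevNorm s f ≤ eLpNorm (A.indicator fun _ ↦ B) 2 volume := by
          refine eLpNorm_mono_enorm_ae ?_
          filter_upwards [hfA] with ξ hξ
          rw [enorm_le_iff_norm_le, hξ]
          by_cases hxA : ξ ∈ A
          · rw [Set.indicator_of_mem hxA, Set.indicator_of_mem hxA, mul_one, Complex.norm_real,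
              Real.norm_of_nonneg (by positivity), Real.norm_of_nonneg hB]
            exact hAB ξ hxA
          · simp [hxA]
      _ = ENNReal.ofReal B * volume A ^ (1 / 2 : ℝ) := by
          rw [eLpNorm_indicator_const hA (by norm_num) (by norm_num),
            Real.enorm_eq_ofReal hB, ENNReal.toReal_ofNat]
  have hlow : ENNReal.ofReal (c * volume.real A) * volume E ^ (1 / 2 : ℝ) ≤
      eLpNorm (maximalFunction γ f) 2 (volume.restrict (Metric.ball (0 : Space d) 1)) := by
    calc ENNReal.ofReal (c * volume.real A) * volume E ^ (1 / 2 : ℝ)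
        = eLpNorm (E.indicator fun _ ↦ c * volume.real A) 2
            (volume.restrict (Metric.ball (0 : Space d) 1)) := by
          rw [eLpNorm_indicator_const hE (by norm_num) (by norm_num),
            Real.enorm_eq_ofReal (by positivity), ENNReal.toReal_ofNat,
            Measure.restrict_apply hE, Set.inter_eq_left.mpr hE1]
      _ ≤ _ := by
          refine eLpNorm_mono_enorm fun x ↦ ?_
          by_cases hx : x ∈ E
          · obtain ⟨t, ht, θ, hθ⟩ := hEt x hx
            rw [Set.indicator_of_mem hx, enorm_eq_self, maximalFunction]
            refine le_trans ?_ (le_iSup₂ (f := fun t _ ↦ ‖P γ f x t‖ₑ) t ht)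
            rw [enorm_le_iff_norm_le, Real.norm_of_nonneg (by positivity)]
            exact le_norm_P hA hAb hfA hθ
          · simp [hx]
  have hall := (hlow.trans (hC f hf)).trans (mul_le_mul_right hup (C : ℝ≥0∞))
  have hreal : c * volume.real A * √(volume.real E) ≤ C * (B * √(volume.real A)) := by
    have h1 := ENNReal.toReal_mono (by finiteness) hall
    simpa [ENNReal.toReal_mul, ← ENNReal.toReal_rpow, ENNReal.toReal_ofReal,
      hB, hc0.le, Real.sqrt_eq_rpow, measureReal_def] using h1
  have hA0 : 0 ≤ volume.real A := measureReal_nonneg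
  rcases hA0.eq_or_lt with h0 | h0
  · rw [← h0, zero_mul]; positivity
  have hs : √(volume.real A) * √(volume.real A) = volume.real A := Real.mul_self_sqrt hA0
  have h5 : √(volume.real A) * √(volume.real E) ≤ (C + 1) / c * B := by
    rw [div_mul_eq_mul_div, le_div_iff₀ hc0]
    have : √(volume.real A) * (√(volume.real A) * √(volume.real E) * c) ≤
        √(volume.real A) * (C * B) := by
      calc _ = c * (√(volume.real A) * √(volume.real A)) * √(volume.real E) := by ring
        _ = c * volume.real A * √(volume.real E) := by rw [hs]
        _ ≤ _ := hreal
        _ = _ := by ring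
    have := le_of_mul_le_mul_left this (Real.sqrt_pos.mpr h0)
    linarith
  calc volume.real A * volume.real E
      = (√(volume.real A) * √(volume.real E)) ^ 2 := by
        rw [mul_pow, Real.sq_sqrt hA0, Real.sq_sqrt measureReal_nonneg]
    _ ≤ ((C + 1) / c * B) ^ 2 := by gcongr
    _ = _ := by ring

/-! ### Boxes, weights and phases -/

theorem measurableSet_box {d : ℕ} {S : Fin d → Set ℝ} (hS : ∀ i, MeasurableSet (S i)) :
    MeasurableSet {ξ : Space d | ∀ i, ξ i ∈ S i} := by
  rw [Set.ofPred_forall]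
  exact MeasurableSet.iInter fun i ↦ (by fun_prop : Measurable fun ξ : Space d ↦ ξ i) (hS i)

theorem volume_real_box {d : ℕ} {S : Fin d → Set ℝ} (hS : ∀ i, MeasurableSet (S i)) :
    volume.real {ξ : Space d | ∀ i, ξ i ∈ S i} = ∏ i, volume.real (S i) := by
  have h := (PiLp.volume_preserving_ofLp (Fin d)).measure_preimage
    (MeasurableSet.univ_pi hS).nullMeasurableSet
  have e : {ξ : Space d | ∀ i, ξ i ∈ S i} = WithLp.ofLp ⁻¹' Set.univ.pi S := by
    ext ξ; simp
  rw [measureReal_def, e, h, volume_pi_pi, ENNReal.toReal_prod]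
  rfl

theorem norm_sq_le_of_abs_le {d : ℕ} {x : Space d} {M : ℝ} (h : ∀ i, |x i| ≤ M) :
    ‖x‖ ^ 2 ≤ d * M ^ 2 := by
  rw [EuclideanSpace.real_norm_sq_eq]
  calc ∑ i, x i ^ 2 ≤ ∑ _i : Fin d, M ^ 2 := Finset.sum_le_sum fun i _ ↦ by
        rw [← sq_abs]; exact pow_le_pow_left₀ (abs_nonneg _) (h i) 2
    _ = d * M ^ 2 := by simp

theorem isBounded_of_abs_le {d : ℕ} {A : Set (Space d)} {M : ℝ} (h : ∀ ξ ∈ A, ∀ i, |ξ i| ≤ M) :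
    Bornology.IsBounded A :=
  (Metric.isBounded_iff_subset_closedBall 0).mpr ⟨√(d * M ^ 2), fun ξ hξ ↦ by
    rw [mem_closedBall_zero_iff]
    exact Real.le_sqrt_of_sq_le (norm_sq_le_of_abs_le (h ξ hξ))⟩

theorem sq_le_norm_sq_of_le {d : ℕ} {x : Space d} {M : ℝ} (hM : 0 ≤ M) (i : Fin d)
    (h : M ≤ x i) : M ^ 2 ≤ ‖x‖ ^ 2 := by
  rw [EuclideanSpace.real_norm_sq_eq]
  exact (pow_le_pow_left₀ hM h 2).trans
    (Finset.single_le_sum (f := fun i ↦ x i ^ 2) (fun _ _ ↦ sq_nonneg _) (Finset.mem_univ i))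

/-- At frequencies comparable to `R`, the Sobolev weight is at most comparable to `R^s`,
whatever the sign of `s`. -/
theorem sobolev_weight_le {d : ℕ} (s : ℝ) {ξ : Space d} {R : ℝ} (hR : 1 ≤ R)
    (h1 : R ^ 2 ≤ ‖ξ‖ ^ 2) (h2 : ‖ξ‖ ^ 2 ≤ d * (2 * R) ^ 2) :
    (1 + ‖ξ‖ ^ 2) ^ (s / 2) ≤ (1 + 4 * d : ℝ) ^ (|s| / 2) * R ^ s := by
  have hR0 : 0 < R := by linarith
  set q := (1 + ‖ξ‖ ^ 2) / R ^ 2 with hq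
  have hq1 : 1 ≤ q := by rw [hq, one_le_div (by positivity)]; linarith
  have hq2 : q ≤ 1 + 4 * d := by
    rw [hq, div_le_iff₀ (by positivity)]
    nlinarith
  have e : 1 + ‖ξ‖ ^ 2 = q * R ^ 2 := by rw [hq]; field_simp
  have e2 : (R ^ 2) ^ (s / 2) = R ^ s := by
    rw [← Real.rpow_natCast_mul hR0.le]
    congr 1; push_cast; ring
  rw [e, Real.mul_rpow (by linarith) (by positivity), e2]
  refine mul_le_mul_of_nonneg_right ?_ (by positivity)
  calc q ^ (s / 2) ≤ q ^ (|s| / 2) :=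
        Real.rpow_le_rpow_of_exponent_le hq1 (by linarith [le_abs_self s])
    _ ≤ _ := Real.rpow_le_rpow (by linarith) hq2 (by positivity)

theorem inner_add_mul_norm_sq {d : ℕ} (x ξ : Space d) (t : ℝ) :
    inner ℝ x ξ + t * ‖ξ‖ ^ 2 = ∑ i, (x i * ξ i + t * ξ i ^ 2) := by
  rw [EuclideanSpace.real_norm_sq_eq, PiLp.inner_apply, Finset.mul_sum, ← Finset.sum_add_distrib]
  refine Finset.sum_congr rfl fun i _ ↦ ?_
  simp [mul_comm]

/-- The phase is a sum over the coordinates, so it suffices to control it in each coordinate. -/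
theorem exists_abs_phase_sub_le {d : ℕ} {x ξ : Space d} {t ε : ℝ} {θ : Fin d → ℝ}
    (h : ∀ i, ∃ m : ℤ, |x i * ξ i + t * ξ i ^ 2 - θ i - 2 * Real.pi * m| ≤ ε) :
    ∃ m : ℤ, |inner ℝ x ξ + t * ‖ξ‖ ^ 2 - ∑ i, θ i - 2 * Real.pi * m| ≤ d * ε := by
  choose m hm using h
  refine ⟨∑ i, m i, ?_⟩
  rw [inner_add_mul_norm_sq]
  push_cast
  rw [Finset.mul_sum, ← Finset.sum_sub_distrib, ← Finset.sum_sub_distrib]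
  calc _ ≤ ∑ i, |x i * ξ i + t * ξ i ^ 2 - θ i - 2 * Real.pi * m i| :=
        Finset.abs_sum_le_sum_abs _ _
    _ ≤ ∑ _i : Fin d, ε := Finset.sum_le_sum fun i _ ↦ hm i
    _ = d * ε := by simp

/-! ### Nonnegative regularity -/

/-- For a frequency cube of side `1` at distance `R` from the origin there is coherence on a fixed
ball as `t → 0`, which rules out negative `s`. -/
theorem MaximalEstimate.nonneg {d : ℕ} (hd : 1 ≤ d) {γ s : ℝ} (hγ : 0 < γ)
    (hmax : MaximalEstimate d γ s) : 0 ≤ s := by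
  obtain ⟨C, hC0, hC⟩ := hmax.exists_volume_mul_volume_le 1
  have hd0 : (1 : ℝ) ≤ d := by exact_mod_cast hd
  set δ : ℝ := 1 / (2 * d) with hδ
  have hδ0 : 0 < δ := by positivity
  have hδd : d * δ = 1 / 2 := by rw [hδ]; field_simp
  set κ : ℝ := (1 + 4 * d : ℝ) ^ (|s| / 2) with hκ
  have key : ∀ R : ℝ, 1 ≤ R → δ ^ d ≤ C * (κ * R ^ s) ^ 2 := by
    intro R hR
    have hR0 : 0 < R := by linarith
    set A : Set (Space d) := {ξ | ∀ i, ξ i ∈ Set.Icc R (R + 1)} with hA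
    set E : Set (Space d) := {x | ∀ i, x i ∈ Set.Icc 0 δ} with hE
    have hAabs : ∀ ξ ∈ A, ∀ i, |ξ i| ≤ 2 * R := fun ξ hξ i ↦ by
      rw [abs_of_nonneg (hR0.le.trans (hξ i).1)]; linarith [(hξ i).2]
    have hA2 : ∀ ξ ∈ A, ‖ξ‖ ^ 2 ≤ d * (2 * R) ^ 2 := fun ξ hξ ↦
      norm_sq_le_of_abs_le (hAabs ξ hξ)
    -- A time so small that neither the dispersive nor the dissipative factor is felt on `A`.
    obtain ⟨t, ht01, ht1, ht2⟩ : ∃ t ∈ Set.Ioo (0 : ℝ) 1, t ^ γ * (d * (2 * R) ^ 2) ≤ 1 ∧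
        t * (d * (2 * R) ^ 2) ≤ 1 / 2 := by
      have c1 : Filter.Tendsto (fun t : ℝ ↦ t ^ γ * (d * (2 * R) ^ 2)) (nhdsWithin 0 (Set.Ioi 0))
          (nhds 0) := by
        have : Continuous fun t : ℝ ↦ t ^ γ * (d * (2 * R) ^ 2) :=
          (Real.continuous_rpow_const hγ.le).mul continuous_const
        have h := this.tendsto 0
        rw [Real.zero_rpow hγ.ne', zero_mul] at h
        exact h.mono_left nhdsWithin_le_nhds
      have c2 : Filter.Tendsto (fun t : ℝ ↦ t * (d * (2 * R) ^ 2)) (nhdsWithin 0 (Set.Ioi 0))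
          (nhds 0) := by
        have : Continuous fun t : ℝ ↦ t * (d * (2 * R) ^ 2) := by fun_prop
        have h := this.tendsto 0
        rw [zero_mul] at h
        exact h.mono_left nhdsWithin_le_nhds
      obtain ⟨t, h1, h2, h3⟩ := ((c1.eventually_le_const (by norm_num : (0 : ℝ) < 1)).and
        ((c2.eventually_le_const (by norm_num : (0 : ℝ) < 1 / 2)).and
          (Ioo_mem_nhdsGT (by norm_num : (0 : ℝ) < 1)))).exists
      exact ⟨t, h3, h1, h2⟩
    have hm := hC A E (κ * R ^ s) (measurableSet_box fun i ↦ measurableSet_Icc)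
      (isBounded_of_abs_le hAabs) (measurableSet_box fun i ↦ measurableSet_Icc) ?_
      (by positivity) (fun ξ hξ ↦ sobolev_weight_le s hR
        (sq_le_norm_sq_of_le hR0.le ⟨0, hd⟩ (hξ ⟨0, hd⟩).1) (hA2 ξ hξ)) ?_
    · rw [volume_real_box fun i ↦ measurableSet_Icc, volume_real_box fun i ↦ measurableSet_Icc]
        at hm
      simpa [hδ0.le] using hm
    · intro x hx
      rw [mem_ball_zero_iff]
      have h1 : ‖x‖ ^ 2 ≤ d * δ ^ 2 := norm_sq_le_of_abs_le fun i ↦ by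
        rw [abs_of_nonneg (hx i).1]; exact (hx i).2
      have h2 : δ ≤ 1 := by nlinarith
      nlinarith [norm_nonneg x]
    · intro x hx
      refine ⟨t, ht01, ∑ i, x i * R, fun ξ hξ ↦ ⟨?_, 0, ?_⟩⟩
      · exact (mul_le_mul_of_nonneg_left (hA2 ξ hξ) (Real.rpow_nonneg ht01.1.le _)).trans ht1
      · have h1 : |∑ i, x i * (ξ i - R)| ≤ d * δ := by
          calc _ ≤ ∑ i, |x i * (ξ i - R)| := Finset.abs_sum_le_sum_abs _ _
            _ ≤ ∑ _i : Fin d, δ := Finset.sum_le_sum fun i _ ↦ by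
                have := hx i
                have := hξ i
                simp only [Set.mem_Icc] at *
                rw [abs_of_nonneg (mul_nonneg (by linarith) (by linarith))]
                nlinarith
            _ = d * δ := by simp
        have h2 : 0 ≤ t * ‖ξ‖ ^ 2 := mul_nonneg ht01.1.le (sq_nonneg _)
        have h3 := (mul_le_mul_of_nonneg_left (hA2 ξ hξ) ht01.1.le).trans ht2
        have e : inner ℝ x ξ + t * ‖ξ‖ ^ 2 - ∑ i, x i * R - 2 * Real.pi * (0 : ℤ) =
            ∑ i, x i * (ξ i - R) + t * ‖ξ‖ ^ 2 := by
          simp only [PiLp.inner_apply, mul_sub, Finset.sum_sub_distrib]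
          simp only [RCLike.inner_apply, conj_trivial, mul_comm]
          push_cast
          ring
        rw [e, abs_le]
        rw [abs_le] at h1
        constructor <;> linarith
  by_contra! hs
  have hlim : Filter.Tendsto (fun R : ℝ ↦ C * (κ * R ^ s) ^ 2) Filter.atTop (nhds 0) := by
    have h1 : Filter.Tendsto (fun R : ℝ ↦ R ^ s) Filter.atTop (nhds 0) := by
      simpa using tendsto_rpow_neg_atTop (neg_pos.mpr hs)
    simpa using ((h1.const_mul κ).pow 2).const_mul C
  have := ge_of_tendsto hlim ((Filter.eventually_ge_atTop 1).mono key)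
  have : 0 < δ ^ d := by positivity
  linarith

/-! ### Equidistribution of multiples of `(p⁻¹, p⁻², …)` -/

/-- The multiples `k • (p⁻¹, …, p⁻ᴺ)` are `1/p`-dense modulo `1`, and the residue class of `k`
modulo `pᴺ` can be prescribed digit by digit. -/
theorem exists_residue_near_int {p : ℕ} (hp : 0 < p) (y : ℕ → ℝ) (N : ℕ) :
    ∃ r : ℤ, ∀ k : ℤ, (p : ℤ) ^ N ∣ k - r → ∀ j < N,
      ∃ m : ℤ, |y j + k * (1 / (p : ℝ) ^ (j + 1)) - m| ≤ 1 / p := by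
  have hp0 : (0 : ℝ) < p := by exact_mod_cast hp
  induction N with
  | zero => exact ⟨0, fun k _ j hj ↦ absurd hj (by simp)⟩
  | succ N ih =>
    obtain ⟨r, hr⟩ := ih
    set v : ℝ := p * (y N + r / (p : ℝ) ^ (N + 1)) with hv
    refine ⟨r - p ^ N * ⌊v⌋, fun k hk j hj ↦ ?_⟩
    rcases Nat.lt_succ_iff_lt_or_eq.mp hj with hj | rfl
    · refine hr k ?_ j hj
      have h1 : (p : ℤ) ^ N ∣ k - (r - p ^ N * ⌊v⌋) := (pow_dvd_pow _ N.le_succ).trans hk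
      have h2 : k - r = k - (r - p ^ N * ⌊v⌋) - p ^ N * ⌊v⌋ := by ring
      rw [h2]
      exact dvd_sub h1 (dvd_mul_right _ _)
    · obtain ⟨m, hm⟩ := hk
      refine ⟨m, ?_⟩
      have hk' : (k : ℝ) = r - p ^ j * ⌊v⌋ + p ^ (j + 1) * m := by
        have : k = r - p ^ j * ⌊v⌋ + p ^ (j + 1) * m := by linarith
        exact_mod_cast this
      have e : y j + k * (1 / (p : ℝ) ^ (j + 1)) - m = Int.fract v / p := by
        rw [hk', Int.fract, eq_div_iff hp0.ne', hv]
        field_simp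
        ring
      rw [e, abs_of_nonneg (div_nonneg (Int.fract_nonneg _) hp0.le)]
      gcongr
      exact (Int.fract_lt_one v).le

/-- Any window of length `pᴺ` contains an integer `k` for which `k • (p⁻¹, …, p⁻ᴺ)` is within
`1/p` of a prescribed point modulo `1`. -/
theorem exists_int_window_near_int {p : ℕ} (hp : 0 < p) (y : ℕ → ℝ) (N : ℕ) (τ : ℝ) :
    ∃ k : ℤ, τ ≤ k ∧ k < τ + p ^ N ∧ ∀ j < N,
      ∃ m : ℤ, |y j + k * (1 / (p : ℝ) ^ (j + 1)) - m| ≤ 1 / p := by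
  obtain ⟨r, hr⟩ := exists_residue_near_int hp y N
  have hp0 : (0 : ℝ) < (p : ℝ) ^ N := by positivity
  obtain ⟨m, hm, -⟩ := existsUnique_add_zsmul_mem_Ico hp0 (r : ℝ) τ
  rw [zsmul_eq_mul, Set.mem_Ico] at hm
  refine ⟨r + m * p ^ N, ?_, ?_, hr _ ?_⟩
  · push_cast; exact hm.1
  · push_cast; exact hm.2
  · rw [add_sub_cancel_left]
    exact dvd_mul_left _ _

/-! ### Trains of frequency intervals -/

/-- The union of the `n` intervals of length `w` that start at the points `Λ (l + α / 2)`,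
`0 ≤ l < n`, of a shifted lattice. -/
def train (Λ α w : ℝ) (n : ℕ) : Set ℝ :=
  ⋃ l ∈ Finset.range n, Set.Ico (Λ * (l + α / 2)) (Λ * (l + α / 2) + w)

theorem mem_train {Λ α w : ℝ} {n : ℕ} {ξ : ℝ} :
    ξ ∈ train Λ α w n ↔
      ∃ l < n, ξ ∈ Set.Ico (Λ * (l + α / 2)) (Λ * (l + α / 2) + w) := by
  simp only [train, Set.mem_iUnion, Finset.mem_range, exists_prop]

theorem measurableSet_train (Λ α w : ℝ) (n : ℕ) : MeasurableSet (train Λ α w n) :=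
  Finset.measurableSet_biUnion _ fun _ _ ↦ measurableSet_Ico

theorem volume_real_train {Λ w : ℝ} (hw : 0 ≤ w) (hwΛ : w ≤ Λ) (α : ℝ) (n : ℕ) :
    volume.real (train Λ α w n) = n * w := by
  have hlt : ∀ l m : ℕ, l < m → Disjoint (Set.Ico (Λ * (l + α / 2)) (Λ * (l + α / 2) + w))
      (Set.Ico (Λ * (m + α / 2)) (Λ * (m + α / 2) + w)) := by
    intro l m hlm
    refine Set.disjoint_left.mpr fun ξ h1 h2 ↦ ?_
    have : (l : ℝ) + 1 ≤ m := by exact_mod_cast hlm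
    have := mul_le_mul_of_nonneg_left this (hw.trans hwΛ)
    linarith [h1.2, h2.1]
  rw [train, measureReal_biUnion_finset ?_ (fun _ _ ↦ measurableSet_Ico)
    fun _ _ ↦ measure_Ico_lt_top.ne]
  · simp [hw]
  · intro l _ m _ hlm
    rcases lt_or_gt_of_ne hlm with h | h
    · exact hlt l m h
    · exact (hlt m l h).symm

theorem train_mem_Icc {Λ α w : ℝ} (hw : 0 ≤ w) (hwΛ : w ≤ Λ) (hα : α ∈ Set.Icc (0 : ℝ) 1)
    {n : ℕ} {ξ : ℝ} (hξ : ξ ∈ train Λ α w n) : ξ ∈ Set.Icc 0 (2 * (n * Λ)) := by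
  obtain ⟨l, hl, h1, h2⟩ := mem_train.mp hξ
  have hl' : (l : ℝ) + 1 ≤ n := by exact_mod_cast hl
  have hΛ := hw.trans hwΛ
  have h3 := mul_le_mul_of_nonneg_left hl' hΛ
  have h4 := mul_nonneg hΛ (Nat.cast_nonneg (α := ℝ) l)
  have h5 := mul_nonneg hΛ hα.1
  have h6 := mul_le_mul_of_nonneg_left hα.2 hΛ
  constructor <;> nlinarith

/-- At the times `t = 2πk/Λ²` the quadratic part of the phase is an integer multiple of `2π` on
the lattice, and the remaining linear part is controlled by the distance of `xΛ/(2π) + kα` to the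
integers. -/
theorem exists_abs_phase_train_sub_le {Λ α w ε x : ℝ} {n : ℕ} (hΛ : 0 < Λ)
    (hα : α ∈ Set.Icc (0 : ℝ) 1) {k m : ℤ} (hk : 0 ≤ k)
    (hm : |x * Λ / (2 * Real.pi) + k * α - m| ≤ ε) {ξ : ℝ} (hξ : ξ ∈ train Λ α w n) {t : ℝ}
    (ht : t = 2 * Real.pi * k / Λ ^ 2) :
    ∃ m' : ℤ, |x * ξ + t * ξ ^ 2 - (x * Λ * α / 2 + t * Λ ^ 2 * α ^ 2 / 4) - 2 * Real.pi * m'| ≤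
      2 * Real.pi * (n * ε) + |x| * w + 2 * t * (n * Λ) * w + t * w ^ 2 := by
  obtain ⟨l, hl, h1, h2⟩ := mem_train.mp hξ
  have hl' : (l : ℝ) + 1 ≤ n := by exact_mod_cast hl
  have hpi := Real.pi_pos
  have ht0 : 0 ≤ t := by
    have : (0 : ℝ) ≤ k := by exact_mod_cast hk
    rw [ht]; positivity
  set ζ := ξ - Λ * (l + α / 2) with hζ
  have hζ0 : 0 ≤ ζ := by rw [hζ]; linarith
  have hζw : ζ ≤ w := by rw [hζ]; linarith
  set e := x * Λ / (2 * Real.pi) + k * α - m with he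
  refine ⟨k * l ^ 2 + l * m, ?_⟩
  have hid : x * ξ + t * ξ ^ 2 - (x * Λ * α / 2 + t * Λ ^ 2 * α ^ 2 / 4) -
      2 * Real.pi * ((k * l ^ 2 + l * m : ℤ) : ℝ) =
      2 * Real.pi * (l * e) + x * ζ + 2 * t * (Λ * (l + α / 2)) * ζ + t * ζ ^ 2 := by
    have hξe : ξ = Λ * (l + α / 2) + ζ := by rw [hζ]; ring
    have htΛ : t * Λ ^ 2 = 2 * Real.pi * k := by rw [ht]; field_simp
    have hxe : 2 * Real.pi * (l * e) = x * Λ * l + 2 * Real.pi * k * (l * α) -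
        2 * Real.pi * (l * m) := by
      rw [he]; field_simp
    rw [hxe, hξe]
    push_cast
    linear_combination ((l : ℝ) ^ 2 + l * α) * htΛ
  rw [hid]
  have b1 : |2 * Real.pi * (l * e)| ≤ 2 * Real.pi * (n * ε) := by
    rw [abs_mul, abs_of_pos (by positivity : 0 < 2 * Real.pi), abs_mul, Nat.abs_cast]
    have : (l : ℝ) * |e| ≤ n * ε :=
      mul_le_mul (by linarith) hm (abs_nonneg _) (by linarith [Nat.cast_nonneg (α := ℝ) l])
    exact mul_le_mul_of_nonneg_left this (by positivity)
  have b2 : |x * ζ| ≤ |x| * w := by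
    rw [abs_mul, abs_of_nonneg hζ0]
    exact mul_le_mul_of_nonneg_left hζw (abs_nonneg _)
  have b3 : |2 * t * (Λ * (l + α / 2)) * ζ| ≤ 2 * t * (n * Λ) * w := by
    have h0 : 0 ≤ (l : ℝ) + α / 2 := by have := hα.1; positivity
    rw [abs_of_nonneg (by positivity)]
    have h3 : Λ * (l + α / 2) ≤ n * Λ := by
      rw [mul_comm]
      exact mul_le_mul_of_nonneg_right (by linarith [hα.2]) hΛ.le
    exact mul_le_mul (mul_le_mul_of_nonneg_left h3 (by positivity)) hζw hζ0 (by positivity)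
  have b4 : |t * ζ ^ 2| ≤ t * w ^ 2 := by
    rw [abs_of_nonneg (by positivity)]
    gcongr
  calc _ ≤ |2 * Real.pi * (l * e)| + |x * ζ| + |2 * t * (Λ * (l + α / 2)) * ζ| + |t * ζ ^ 2| :=
        (abs_add_le _ _).trans (by gcongr; exact abs_add_three _ _ _)
    _ ≤ _ := by linarith

/-- A single frequency interval `[R, R + w)` is coherent as long as the wave, moving with velocity
`-2R`, is within `v` of the origin and has not yet dispersed. -/
theorem abs_phase_interval_sub_le {R w v x t ξ : ℝ} (ht : 0 ≤ t) (hv : |x + 2 * R * t| ≤ v)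
    (hξ : ξ ∈ Set.Ico R (R + w)) :
    |x * ξ + t * ξ ^ 2 - (x * R + t * R ^ 2)| ≤ v * w + t * w ^ 2 := by
  have h0 : 0 ≤ ξ - R := by linarith [hξ.1]
  have h1 : ξ - R ≤ w := by linarith [hξ.2]
  have e : x * ξ + t * ξ ^ 2 - (x * R + t * R ^ 2) =
      (x + 2 * R * t) * (ξ - R) + t * (ξ - R) ^ 2 := by ring
  rw [e]
  refine (abs_add_le _ _).trans (add_le_add ?_ ?_)
  · rw [abs_mul, abs_of_nonneg h0]
    exact mul_le_mul hv h1 h0 ((abs_nonneg _).trans hv)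
  · rw [abs_of_nonneg (by positivity)]
    gcongr

/-! ### The coherent example -/

/-- The frequency set of the example: an interval of length `δ/h` at `R` in the first coordinate,
and in the `j`-th of the other coordinates a train of `n` intervals of length `δ/(R h²)` with
spacing `R/n`, shifted by `p⁻ʲ/2` spacings. -/
def freqSide (N n p : ℕ) (R h δ : ℝ) : Fin (N + 1) → Set ℝ :=
  Fin.cons (Set.Ico R (R + δ / h))
    fun j : Fin N ↦ train (R / n) (1 / (p : ℝ) ^ ((j : ℕ) + 1)) (δ / (R * h ^ 2)) n

/-- The sides of the box of size `δ R h²` in physical space on which the maximal function is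
large; the first coordinate is negative since waves at frequency `R` move with velocity `-2R`. -/
def spaceSide (N : ℕ) (R h δ : ℝ) : Fin (N + 1) → Set ℝ :=
  Fin.cons (Set.Icc (-(δ * (R * h ^ 2))) (-(δ * (R * h ^ 2) / 2)))
    fun _ : Fin N ↦ Set.Icc 0 (δ * (R * h ^ 2))

section

variable {N n p : ℕ} {R h δ : ℝ}

theorem measurableSet_freqSide (i : Fin (N + 1)) : MeasurableSet (freqSide N n p R h δ i) := by
  refine Fin.cases ?_ (fun j ↦ ?_) i
  · exact measurableSet_Ico
  · exact measurableSet_train _ _ _ _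

theorem measurableSet_spaceSide (i : Fin (N + 1)) : MeasurableSet (spaceSide N R h δ i) := by
  refine Fin.cases ?_ (fun j ↦ ?_) i <;> exact measurableSet_Icc

theorem shift_mem_Icc (hp : 1 ≤ p) (j : ℕ) : 1 / (p : ℝ) ^ (j + 1) ∈ Set.Icc (0 : ℝ) 1 := by
  have : (1 : ℝ) ≤ (p : ℝ) ^ (j + 1) := one_le_pow₀ (by exact_mod_cast hp)
  exact ⟨by positivity, by rw [div_le_one (by positivity)]; exact this⟩

theorem train_width_le (hR : 0 < R) (hh : 0 < h) (hδ1 : δ ≤ 1) (hn : 1 ≤ n)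
    (hRn : n ≤ R * h) (hR1 : 1 ≤ R * h) : δ / (R * h ^ 2) ≤ R / n := by
  have hn0 : (0 : ℝ) < n := by exact_mod_cast hn
  rw [div_le_div_iff₀ (by positivity) hn0]
  calc δ * n ≤ 1 * (R * h) := mul_le_mul hδ1 hRn hn0.le zero_le_one
    _ ≤ (R * h) * (R * h) := mul_le_mul_of_nonneg_right hR1 (by positivity)
    _ = R * (R * h ^ 2) := by ring

theorem freqSide_abs_le (hR : 0 < R) (hh : 0 < h) (hδ0 : 0 ≤ δ) (hδ1 : δ ≤ 1) (hn : 1 ≤ n)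
    (hp : 1 ≤ p) (hRn : n ≤ R * h) (hR1 : 1 ≤ R * h) (i : Fin (N + 1)) {ξ : ℝ}
    (hξ : ξ ∈ freqSide N n p R h δ i) : |ξ| ≤ 2 * R := by
  have hn0 : (0 : ℝ) < n := by exact_mod_cast hn
  revert hξ
  refine Fin.cases (fun hξ ↦ ?_) (fun j hξ ↦ ?_) i
  · obtain ⟨h1, h2⟩ := hξ
    have : δ / h ≤ R := by rw [div_le_iff₀ hh]; linarith
    rw [abs_of_nonneg (by linarith)]
    linarith
  · have := train_mem_Icc (by positivity) (train_width_le hR hh hδ1 hn hRn hR1)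
      (shift_mem_Icc hp j) hξ
    rw [abs_of_nonneg this.1]
    refine this.2.trans_eq ?_
    field_simp

theorem volume_real_freqSide_mul_spaceSide (hR : 0 < R) (hh : 0 < h) (hδ0 : 0 ≤ δ) (hδ1 : δ ≤ 1)
    (hn : 1 ≤ n) (hRn : n ≤ R * h) (hR1 : 1 ≤ R * h) :
    volume.real {ξ : Space (N + 1) | ∀ i, ξ i ∈ freqSide N n p R h δ i} *
      volume.real {x : Space (N + 1) | ∀ i, x i ∈ spaceSide N R h δ i} =
      δ ^ (2 * (N + 1)) / 2 * (R * h) * n ^ N := by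
  have hn0 : (0 : ℝ) < n := by exact_mod_cast hn
  rw [volume_real_box measurableSet_freqSide, volume_real_box measurableSet_spaceSide,
    Fin.prod_univ_succ, Fin.prod_univ_succ]
  simp only [freqSide, spaceSide, Fin.cons_zero, Fin.cons_succ]
  have e0 : volume.real (Set.Ico R (R + δ / h)) = δ / h := by
    rw [Real.volume_real_Ico_of_le (by linarith [div_nonneg hδ0 hh.le])]; ring
  have e1 : volume.real (Set.Icc (-(δ * (R * h ^ 2))) (-(δ * (R * h ^ 2) / 2))) =
      δ * (R * h ^ 2) / 2 := by
    have : 0 ≤ δ * (R * h ^ 2) := by positivity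
    rw [Real.volume_real_Icc_of_le (by linarith)]; ring
  have e2 : volume.real (Set.Icc 0 (δ * (R * h ^ 2))) = δ * (R * h ^ 2) := by
    rw [Real.volume_real_Icc_of_le (by positivity)]; ring
  have e3 : ∀ j : Fin N, volume.real
      (train (R / n) (1 / (p : ℝ) ^ ((j : ℕ) + 1)) (δ / (R * h ^ 2)) n) =
      n * (δ / (R * h ^ 2)) := fun j ↦
    volume_real_train (by positivity) (train_width_le hR hh hδ1 hn hRn hR1) _ _
  simp only [e0, e1, e2, e3, Finset.prod_const, Finset.card_univ, Fintype.card_fin]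
  have e4 : (n * (δ / (R * h ^ 2))) ^ N * (δ * (R * h ^ 2)) ^ N = n ^ N * δ ^ (2 * N) := by
    rw [← mul_pow, pow_mul, ← mul_pow]
    congr 1
    field_simp
  calc _ = δ / h * (δ * (R * h ^ 2) / 2) *
        ((n * (δ / (R * h ^ 2))) ^ N * (δ * (R * h ^ 2)) ^ N) := by ring
    _ = _ := by
        rw [e4]
        field_simp
        ring

/-- Every point of the box admits a time `t ≤ h²` at which all frequencies of the example are
coherent. The first coordinate confines `t` to a window of length `h/(2R)`; among the times
`2πk(n/R)²` in this window there is one for which the shifts of the trains line up with the other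
coordinates. -/
theorem exists_coherent_time {K : ℕ} (hK : K = 35 * (N + 1)) (hδ : δ = 1 / (5 * (N + 1)))
    (hp : p = K * n) (hR : 0 < R) (hh : 0 < h) (hn : 1 ≤ n)
    (hRH : R * h = 13 * K ^ N * n ^ (N + 2)) (hR1 : 1 ≤ R * h)
    {x : Space (N + 1)} (hx : ∀ i, x i ∈ spaceSide N R h δ i) :
    ∃ t, 0 < t ∧ t ≤ h ^ 2 ∧ ∃ θ : ℝ, ∀ ξ : Space (N + 1), (∀ i, ξ i ∈ freqSide N n p R h δ i) →
      ∃ m : ℤ, |inner ℝ x ξ + t * ‖ξ‖ ^ 2 - θ - 2 * Real.pi * m| ≤ 1 := by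
  have hn0 : (0 : ℝ) < n := by exact_mod_cast hn
  have hK0 : 0 < K := by omega
  have hKr : (K : ℝ) = 35 * (N + 1) := by rw [hK]; push_cast; ring
  have hKpos : (0 : ℝ) < K := by exact_mod_cast hK0
  have hp0 : 0 < p := by rw [hp]; positivity
  have hN1 : (1 : ℝ) ≤ (N : ℝ) + 1 := by linarith [Nat.cast_nonneg (α := ℝ) N]
  have hδ0 : 0 < δ := by rw [hδ]; positivity
  have hδ1 : δ ≤ 1 := by rw [hδ, div_le_one (by positivity)]; linarith
  have hδK : δ = 7 / K := by rw [hδ, hKr]; field_simp; norm_num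
  have hpi := Real.pi_pos
  set Λ : ℝ := R / n with hΛ
  have hΛ0 : 0 < Λ := by positivity
  have hx0 : x 0 ∈ Set.Icc (-(δ * (R * h ^ 2))) (-(δ * (R * h ^ 2) / 2)) := hx 0
  have hxj : ∀ j : Fin N, x j.succ ∈ Set.Icc 0 (δ * (R * h ^ 2)) := fun j ↦ hx j.succ
  -- `t₀` is the time at which a wave at frequency `R` reaches the origin from `x 0`.
  set t₀ : ℝ := -x 0 / (2 * R) with ht₀
  have ht₀0 : 0 < t₀ := by
    have : 0 < δ * (R * h ^ 2) := by positivity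
    exact div_pos (by linarith [hx0.2]) (by positivity)
  have ht₀1 : t₀ ≤ h ^ 2 / 2 := by
    rw [ht₀, div_le_iff₀ (by positivity)]
    have : δ * (R * h ^ 2) ≤ 1 * (R * h ^ 2) := by gcongr
    nlinarith [hx0.1]
  obtain ⟨k, hk1, hk2, hk3⟩ := exists_int_window_near_int hp0
    (fun j ↦ if hj : j < N then x (Fin.succ ⟨j, hj⟩) * Λ / (2 * Real.pi) else 0) N
    (t₀ * Λ ^ 2 / (2 * Real.pi))
  set t : ℝ := 2 * Real.pi * k / Λ ^ 2 with ht
  have htlow : t₀ ≤ t := by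
    rw [ht, le_div_iff₀ (by positivity)]
    rw [div_le_iff₀ (by positivity)] at hk1
    linarith
  have ht0 : 0 < t := ht₀0.trans_le htlow
  have hwin : t - t₀ ≤ h / (2 * R) := by
    have h1 : k - t₀ * Λ ^ 2 / (2 * Real.pi) ≤ (K : ℝ) ^ N * n ^ N := by
      rw [hp] at hk2
      push_cast at hk2
      rw [mul_pow] at hk2
      linarith
    have h2 : t - t₀ = (k - t₀ * Λ ^ 2 / (2 * Real.pi)) * (2 * Real.pi * n ^ 2 / R ^ 2) := by
      rw [ht, hΛ]; field_simp
    rw [h2]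
    calc _ ≤ ((K : ℝ) ^ N * n ^ N) * (2 * Real.pi * n ^ 2 / R ^ 2) := by gcongr
      _ = 4 * Real.pi * (K ^ N * n ^ (N + 2)) / (2 * R ^ 2) := by ring
      _ ≤ 13 * (K ^ N * n ^ (N + 2)) / (2 * R ^ 2) := by
          gcongr
          linarith [Real.pi_lt_d2]
      _ = R * h / (2 * R ^ 2) := by rw [hRH]; ring
      _ = h / (2 * R) := by field_simp
  have hth : t ≤ h ^ 2 := by
    have : h / (2 * R) ≤ h ^ 2 / 2 := by
      rw [div_le_iff₀ (by positivity)]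
      nlinarith
    linarith
  have hv : |x 0 + 2 * R * t| ≤ h := by
    have e : x 0 + 2 * R * t = 2 * R * (t - t₀) := by rw [ht₀]; field_simp; ring
    rw [e, abs_of_nonneg (mul_nonneg (by positivity) (by linarith))]
    calc 2 * R * (t - t₀) ≤ 2 * R * (h / (2 * R)) := by gcongr
      _ = h := by field_simp
  have hk0 : 0 ≤ k := by
    have : (0 : ℝ) ≤ k := le_trans (by positivity) hk1
    exact_mod_cast this
  have hδ2 : δ ^ 2 ≤ δ := by nlinarith
  refine ⟨t, ht0, hth, ∑ i, (Fin.cons (x 0 * R + t * R ^ 2) (fun j : Fin N ↦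
    x j.succ * Λ * (1 / (p : ℝ) ^ ((j : ℕ) + 1)) / 2 +
      t * Λ ^ 2 * (1 / (p : ℝ) ^ ((j : ℕ) + 1)) ^ 2 / 4) : Fin (N + 1) → ℝ) i, fun ξ hξ ↦ ?_⟩
  have hsum : ((N + 1 : ℕ) : ℝ) * (5 * δ) = 1 := by
    rw [hδ]; push_cast; field_simp
  refine (exists_abs_phase_sub_le (ε := 5 * δ) fun i ↦ ?_).imp fun m hm ↦ hm.trans_eq hsum
  refine Fin.cases ?_ (fun j ↦ ?_) i
  · refine ⟨0, ?_⟩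
    have h1 := abs_phase_interval_sub_le ht0.le hv (hξ 0)
    simp only [Fin.cons_zero, Int.cast_zero, mul_zero, sub_zero]
    refine h1.trans ?_
    have h2 : h * (δ / h) = δ := by field_simp
    have h3 : t * (δ / h) ^ 2 ≤ δ ^ 2 := by
      calc t * (δ / h) ^ 2 ≤ h ^ 2 * (δ / h) ^ 2 := by gcongr
        _ = δ ^ 2 := by field_simp
    linarith
  · obtain ⟨m, hm⟩ := hk3 j j.isLt
    rw [dif_pos j.isLt] at hm
    obtain ⟨m', hm'⟩ := exists_abs_phase_train_sub_le hΛ0 (shift_mem_Icc hp0 j) hk0 hm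
      (hξ j.succ) ht
    refine ⟨m', ?_⟩
    simp only [Fin.cons_succ]
    refine hm'.trans ?_
    have h1 : 2 * Real.pi * (n * (1 / p)) ≤ δ := by
      have e : 2 * Real.pi * (n * (1 / p)) = 2 * Real.pi / K := by
        rw [hp]; push_cast; field_simp
      rw [e, hδK]
      gcongr
      linarith [Real.pi_lt_d2]
    have h2 : |x j.succ| * (δ / (R * h ^ 2)) ≤ δ ^ 2 := by
      rw [abs_of_nonneg (hxj j).1]
      calc _ ≤ (δ * (R * h ^ 2)) * (δ / (R * h ^ 2)) := by gcongr; exact (hxj j).2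
        _ = δ ^ 2 := by field_simp
    have h3 : 2 * t * (n * Λ) * (δ / (R * h ^ 2)) ≤ 2 * δ := by
      calc _ ≤ 2 * h ^ 2 * (n * Λ) * (δ / (R * h ^ 2)) := by gcongr
        _ = 2 * δ := by rw [hΛ]; field_simp
    have h4 : t * (δ / (R * h ^ 2)) ^ 2 ≤ δ ^ 2 := by
      calc _ ≤ h ^ 2 * (δ / (R * h ^ 2)) ^ 2 := by gcongr
        _ = δ ^ 2 / (R * h) ^ 2 := by field_simp
        _ ≤ δ ^ 2 := div_le_self (by positivity) (one_le_pow₀ hR1)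
    linarith

end

/-- The inequality between the number `n` of frequency intervals per coordinate and the frequency
`R` that the maximal estimate imposes through the coherent example on the time scale `h²`. -/
theorem MaximalEstimate.exists_pow_le {N : ℕ} {γ s : ℝ} (hγ : 0 < γ)
    (hmax : MaximalEstimate (N + 1) γ s) :
    ∃ C H : ℝ, 1 ≤ H ∧ ∀ (n : ℕ) (R h : ℝ), 1 ≤ n → 1 ≤ R → 0 < h → h < 1 → R * h ^ 2 ≤ 1 →
      (h ^ 2) ^ γ * R ^ 2 ≤ 1 → R * h = H * n ^ (N + 2) →
      (n : ℝ) ^ (2 * (N + 1)) ≤ C * (R ^ s) ^ 2 := by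
  obtain ⟨C, hC0, hC⟩ := hmax.exists_volume_mul_volume_le (4 * ((N + 1 : ℕ) : ℝ))
  obtain ⟨K, hK⟩ : ∃ K : ℕ, K = 35 * (N + 1) := ⟨_, rfl⟩
  obtain ⟨δ, hδ⟩ : ∃ δ : ℝ, δ = 1 / (5 * (N + 1)) := ⟨_, rfl⟩
  have hKpos : (1 : ℝ) ≤ K := by
    have : 1 ≤ K := by omega
    exact_mod_cast this
  have hN1 : (1 : ℝ) ≤ (N : ℝ) + 1 := by linarith [Nat.cast_nonneg (α := ℝ) N]
  have hδ0 : 0 < δ := by rw [hδ]; positivity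
  have hδ1 : δ < 1 := by rw [hδ, div_lt_one (by positivity)]; linarith
  have hδN : (N + 1 : ℝ) * δ = 1 / 5 := by rw [hδ]; field_simp
  have hH1 : (1 : ℝ) ≤ 13 * (K : ℝ) ^ N := by linarith [one_le_pow₀ hKpos (n := N)]
  set κ : ℝ := (1 + 4 * ((N + 1 : ℕ) : ℝ)) ^ (|s| / 2) with hκ
  set c : ℝ := δ ^ (2 * (N + 1)) / 2 * (13 * K ^ N) with hc
  have hc0 : 0 < c := by positivity
  refine ⟨C * κ ^ 2 / c, 13 * K ^ N, hH1, fun n R h hn hR hh hh1 hRh hRγ hRH ↦ ?_⟩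
  have hR0 : 0 < R := by linarith
  have hn1 : (1 : ℝ) ≤ n := by exact_mod_cast hn
  have hRn : (n : ℝ) ≤ R * h := by
    rw [hRH]
    calc (n : ℝ) ≤ (n : ℝ) ^ (N + 2) := le_self_pow₀ hn1 (by omega)
      _ ≤ _ := le_mul_of_one_le_left (by positivity) hH1
  have hR1 : 1 ≤ R * h := hn1.trans hRn
  obtain ⟨p, hp⟩ : ∃ p : ℕ, p = K * n := ⟨_, rfl⟩
  have hp1 : 1 ≤ p := by rw [hp]; exact Nat.mul_pos (by omega) hn
  have hAabs : ∀ ξ ∈ {ξ : Space (N + 1) | ∀ i, ξ i ∈ freqSide N n p R h δ i},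
      ∀ i, |ξ i| ≤ 2 * R := fun ξ hξ i ↦
    freqSide_abs_le hR0 hh hδ0.le hδ1.le hn hp1 hRn hR1 i (hξ i)
  have hA2 : ∀ ξ ∈ {ξ : Space (N + 1) | ∀ i, ξ i ∈ freqSide N n p R h δ i},
      ‖ξ‖ ^ 2 ≤ ((N + 1 : ℕ) : ℝ) * (2 * R) ^ 2 := fun ξ hξ ↦ norm_sq_le_of_abs_le (hAabs ξ hξ)
  have hm := hC {ξ | ∀ i, ξ i ∈ freqSide N n p R h δ i} {x | ∀ i, x i ∈ spaceSide N R h δ i}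
    (κ * R ^ s) (measurableSet_box measurableSet_freqSide) (isBounded_of_abs_le hAabs)
    (measurableSet_box measurableSet_spaceSide) ?_ (by positivity)
    (fun ξ hξ ↦ sobolev_weight_le s hR (sq_le_norm_sq_of_le hR0.le 0 (hξ 0).1) (hA2 ξ hξ)) ?_
  · rw [volume_real_freqSide_mul_spaceSide hR0 hh hδ0.le hδ1.le hn hRn hR1, hRH] at hm
    rw [div_mul_eq_mul_div, le_div_iff₀ hc0, hc]
    calc _ = δ ^ (2 * (N + 1)) / 2 * (13 * K ^ N * n ^ (N + 2)) * n ^ N := by ring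
      _ ≤ _ := hm
      _ = _ := by ring
  · intro x hx
    rw [mem_ball_zero_iff]
    have hle : δ * (R * h ^ 2) ≤ δ := mul_le_of_le_one_right hδ0.le hRh
    have h1 : ‖x‖ ^ 2 ≤ ((N + 1 : ℕ) : ℝ) * δ ^ 2 := by
      refine norm_sq_le_of_abs_le fun i ↦ ?_
      have hxi := hx i
      revert hxi
      have : 0 < δ * (R * h ^ 2) := by positivity
      refine Fin.cases (fun hxi ↦ ?_) (fun j hxi ↦ ?_) i
      · rw [abs_le]
        constructor <;> linarith [hxi.1, hxi.2]
      · rw [abs_of_nonneg hxi.1]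
        exact hxi.2.trans hle
    push_cast at h1
    have h2 : ‖x‖ ^ 2 < 1 := by
      calc _ ≤ (N + 1 : ℝ) * δ ^ 2 := h1
        _ = (N + 1 : ℝ) * δ * δ := by ring
        _ < 1 := by rw [hδN]; linarith
    exact (sq_lt_one_iff₀ (norm_nonneg x)).mp h2
  · intro x hx
    obtain ⟨t, ht0, hth, θ, hθ⟩ := exists_coherent_time hK hδ hp hR0 hh hn hRH hR1 hx
    refine ⟨t, ⟨ht0, hth.trans_lt (by nlinarith)⟩, θ, fun ξ hξ ↦ ⟨?_, hθ ξ hξ⟩⟩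
    calc t ^ γ * ‖ξ‖ ^ 2 ≤ (h ^ 2) ^ γ * (((N + 1 : ℕ) : ℝ) * (2 * R) ^ 2) :=
          mul_le_mul (Real.rpow_le_rpow ht0.le hth hγ.le) (hA2 ξ hξ) (by positivity)
            (by positivity)
      _ = 4 * ((N + 1 : ℕ) : ℝ) * ((h ^ 2) ^ γ * R ^ 2) := by ring
      _ ≤ 4 * ((N + 1 : ℕ) : ℝ) * 1 := by gcongr
      _ = _ := mul_one _

/-! ### Choice of the time scale -/

theorem exponent_le_of_forall_rpow_le {a b C : ℝ}
    (h : ∀ n : ℕ, 2 ≤ n → (n : ℝ) ^ a ≤ C * (n : ℝ) ^ b) : a ≤ b := by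
  by_contra! hab
  have h1 : Filter.Tendsto (fun n : ℕ ↦ (n : ℝ) ^ (a - b)) Filter.atTop Filter.atTop :=
    (tendsto_rpow_atTop (sub_pos.mpr hab)).comp tendsto_natCast_atTop_atTop
  obtain ⟨n, hn1, hn2⟩ := ((h1.eventually_gt_atTop C).and (Filter.eventually_ge_atTop 2)).exists
  have hn0 : (0 : ℝ) < n := by exact_mod_cast (by omega : 0 < n)
  rw [Real.rpow_sub hn0, lt_div_iff₀ (by positivity)] at hn1
  exact absurd (h n hn2) (not_le.mpr hn1)

/-- The coherent example on the time scale `R^{-β}`. The bound `1 ≤ β` keeps it inside the unit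
ball, and the bound `2 ≤ β * γ` keeps the dissipation harmless. -/
theorem MaximalEstimate.le_of_timescale {N : ℕ} {γ s β : ℝ} (hγ : 0 < γ)
    (hmax : MaximalEstimate (N + 1) γ s) (hβ1 : 1 ≤ β) (hβ2 : β < 2) (hβγ : 2 ≤ β * γ) :
    (N + 1 : ℝ) / (N + 2) * (1 - β / 2) ≤ s := by
  obtain ⟨C, H, hH, hC⟩ := hmax.exists_pow_le hγ
  set σ : ℝ := 1 - β / 2 with hσ
  have hσ0 : 0 < σ := by rw [hσ]; linarith
  have hN : (0 : ℝ) < (N : ℝ) + 2 := by positivity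
  have key : ∀ n : ℕ, 2 ≤ n → (n : ℝ) ^ (2 * (N + 1) : ℝ) ≤
      C * H ^ (2 * s / σ) * (n : ℝ) ^ ((N + 2) * (2 * s / σ) : ℝ) := by
    intro n hn
    have hn2 : (2 : ℝ) ≤ n := by exact_mod_cast hn
    have hn0 : (0 : ℝ) < n := by linarith
    set X : ℝ := H * n ^ (N + 2) with hX
    have hX1 : 1 < X := by
      have h1 : (1 : ℝ) < (n : ℝ) ^ (N + 2) := one_lt_pow₀ (by linarith) (by omega)
      rw [hX]; nlinarith
    have hX0 : 0 < X := by linarith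
    set R : ℝ := X ^ (1 / σ) with hR
    have hR1 : 1 < R := Real.one_lt_rpow hX1 (by positivity)
    have hR0 : 0 < R := by linarith
    have hh2 : (R ^ (-β / 2)) ^ 2 = R ^ (-β) := by
      rw [← Real.rpow_mul_natCast hR0.le]; congr 1; push_cast; ring
    have hm := hC n R (R ^ (-β / 2)) (by omega) hR1.le (by positivity)
      (Real.rpow_lt_one_of_one_lt_of_neg hR1 (by linarith)) ?_ ?_ ?_
    · have e1 : (n : ℝ) ^ (2 * (N + 1) : ℝ) = (n : ℝ) ^ (2 * (N + 1)) := by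
        rw [← Real.rpow_natCast]; push_cast; rfl
      have e2 : (R ^ s) ^ 2 = H ^ (2 * s / σ) * (n : ℝ) ^ ((N + 2) * (2 * s / σ) : ℝ) := by
        calc (R ^ s) ^ 2 = X ^ (2 * s / σ) := by
              rw [← Real.rpow_mul_natCast hR0.le, hR, ← Real.rpow_mul hX0.le]
              congr 1; push_cast; ring
          _ = _ := by
              rw [hX, Real.mul_rpow (by linarith) (by positivity), ← Real.rpow_natCast_mul hn0.le]
              push_cast; rfl
      rw [e1, mul_assoc, ← e2]
      exact hm
    · rw [hh2]
      nth_rw 1 [← Real.rpow_one R]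
      rw [← Real.rpow_add hR0]
      exact Real.rpow_le_one_of_one_le_of_nonpos hR1.le (by linarith)
    · rw [hh2, ← Real.rpow_mul hR0.le, ← Real.rpow_natCast R 2, ← Real.rpow_add hR0]
      exact Real.rpow_le_one_of_one_le_of_nonpos hR1.le (by push_cast; linarith)
    · nth_rw 1 [← Real.rpow_one R]
      rw [← Real.rpow_add hR0, hR, ← Real.rpow_mul hX0.le]
      have : 1 / σ * (1 + -β / 2) = 1 := by
        have : 1 + -β / 2 = σ := by rw [hσ]; ring
        rw [this]; field_simp
      rw [this, Real.rpow_one]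
  have h1 := exponent_le_of_forall_rpow_le key
  have h2 : (N + 2) * (2 * s / σ) = 2 * ((N + 2) * s) / σ := by ring
  rw [h2, le_div_iff₀ hσ0] at h1
  rw [div_mul_eq_mul_div, div_le_iff₀ hN]
  linarith

end ComplexTimeSchrodinger

end

theorem mainTheorem3 (d : ℕ) (hd : 2 ≤ d) (γ : ℝ) (hγ : 0 < γ) (s : ℝ)
    (hmax : ComplexTimeSchrodinger.MaximalEstimate d γ s) :
    min ((d : ℝ) / (d + 1) * max (1 - 1 / γ) 0) ((d : ℝ) / (2 * (d + 1))) ≤ s := by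
  rcases le_or_gt γ 1 with h1 | h1
  · have h2 : 1 - 1 / γ ≤ 0 := by
      have : 1 ≤ 1 / γ := by rw [le_div_iff₀ hγ]; linarith
      linarith
    rw [max_eq_right h2, mul_zero]
    exact (min_le_left _ _).trans (hmax.nonneg (by omega) hγ)
  · obtain ⟨N, rfl⟩ : ∃ N, d = N + 1 := ⟨d - 1, by omega⟩
    rcases le_or_gt γ 2 with h2 | h2
    -- For `γ ≤ 2` the dissipation limits the time scale to `R^{-2/γ}`.
    · have h3 := hmax.le_of_timescale (β := 2 / γ) hγ (by rw [le_div_iff₀ hγ]; linarith)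
        (by rw [div_lt_iff₀ hγ]; linarith) (by field_simp; exact le_rfl)
      refine (min_le_left _ _).trans (le_trans (le_of_eq ?_) h3)
      have h4 : 0 ≤ 1 - 1 / γ := by
        have : 1 / γ ≤ 1 := by rw [div_le_iff₀ hγ]; linarith
        linarith
      rw [max_eq_left h4]
      push_cast
      ring
    -- For `γ > 2` the limit is the size of the unit ball, which is crossed in time `R^{-1}`.
    · have h3 := hmax.le_of_timescale (β := 1) hγ le_rfl (by norm_num) (by linarith)
      refine (min_le_right _ _).trans (le_trans (le_of_eq ?_) h3)
      push_cast
      field_simp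
      ring
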